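/- Let $\mathbb{U}=\{z\in\mathbb{C}:|z|<1\}$. A function is univalent in $\mathbb{U}$ if it is holomorphic and injective there, and convex if moreover its image is a convex set. For $g,h$ holomorphic in $\mathbb{U}$ write $g\prec h$ if $g=h\circ\omega$ for some holomorphic $\omega\colon\mathbb{U}\to\mathbb{U}$ with $\omega(0)=0$. Let $\mathcal{H}[a,n]$ be the class of holomorphic functions $a+a_nz^n+a_{n+1}z^{n+1}+\cdots$ in $\mathbb{U}$. For $g$ holomorphic in $\mathbb{U}$ let $\mathbf{E}(g)$ be the set of all $\zeta\in\partial\mathbb{U}$ with $\lim_{z\to\zeta}g(z)=\infty$ ($z\in\mathbb{U}$). Let $\mathcal{Q}$ be the class of those $g$ which extend to an analytic and injective function on $\overline{\mathbb{U}}\setminus\mathbf{E}(g)$ such that, for some $\rho>0$, $|g'(\zeta)|\ge\rho$ for all $\zeta\in\partial\mathbb{U}\setminus\mathbf{E}(g)$. Let $p\ge 1$ be an integer, let $\eta,\mu\in\mathbb{C}$ be not both zero, let $\sigma\in\mathbb{C}$ and $\gamma\in\mathbb{C}\setminus\{0\}$, and let $f(z)=z^p+\sum_{k\ge p+1}a_kz^k$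 be holomorphic in $\mathbb{U}$. Put $$F_p^{\eta,\mu}[f](z)=\Big[\frac{f'(z)}{pz^{p-1}}\Big]^{\eta}\Big[\frac{z^p}{f(z)}\Big]^{\mu},\qquad F_p^{\eta,\mu}[f](0)=1,$$ $$\Psi(z)=\Big[\frac{f'(z)}{pz^{p-1}}\Big]^{\eta}\Big[\frac{z^p}{f(z)}\Big]^{\mu}\Big\{\sigma+\gamma\Big[\eta\Big(1-p+\frac{zf''(z)}{f'(z)}\Big)+\mu\Big(p-\frac{zf'(z)}{f(z)}\Big)\Big]\Big\}.$$ The powers are principal near the origin, where both bases are close to $1$, and $F_p^{\eta,\mu}[f]$ and $\Psi$ denote the holomorphic functions in $\mathbb{U}$ given by these expressions near the origin (removable singularities being filled in), where such functions exist. Theorem. Let $q$ be convex in $\mathbb{U}$ with $q(0)=1$, and let $\operatorname{Re}(\sigma/\gamma)>0$. Suppose that $F_p^{\eta,\mu}[f]\in\mathcal{H}[1,1]\cap\mathcal{Q}$, that $\Psi$ is univalent in $\mathbb{U}$, and that $$\sigma q(z)+\gamma zq'(z)\prec\Psi(z).$$ Then $q\prec F_p^{\eta,\mu}[f]$, and $q$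 is the best subordinant of the differential superordination $$h(z):=\sigma q(z)+\gamma zq'(z)\prec\sigma g(z)+\gamma zg'(z),\qquad (\ast)$$ that is: $h$ and $q$ are univalent in $\mathbb{U}$; $q\prec g$ for every univalent $g$ in $\mathbb{U}$ for which $\sigma g+\gamma zg'$ is univalent in $\mathbb{U}$ and $(\ast)$ holds; and every holomorphic $r$ in $\mathbb{U}$ with the property that $r\prec g$ for all such $g$ satisfies $r\prec q$. -/

import Mathlib

open Filter Topology Metric

namespace PValent

/-- The open unit disc of the complex plane. -/
abbrev disc : Set ℂ := ball (0 : ℂ) 1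

/-- `g` is univalent in the unit disc: holomorphic and injective there. -/
def Univalent (g : ℂ → ℂ) : Prop :=
  DifferentiableOn ℂ g disc ∧ Set.InjOn g disc

/-- Convex function in the unit disc: univalent with convex image. -/
def ConvexFunction (q : ℂ → ℂ) : Prop :=
  Univalent q ∧ Convex ℝ (q '' disc)

/-- The class `H[a, n]` of holomorphic functions `a + a_n z ^ n + a_{n+1} z ^ (n+1) + ⋯`
in the unit disc. -/
def classH (a : ℂ) (n : ℕ) : Set (ℂ → ℂ) :=
  {g | DifferentiableOn ℂ g disc ∧
    ∃ c : ℕ → ℂ, ∀ z ∈ disc, HasSum (fun k : ℕ => c k * z ^ (n + k)) (g z - a)}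

/-- The class `A_p` of holomorphic functions `z ^ p + ∑_{k ≥ p + 1} a_k z ^ k`
in the unit disc. -/
def classA (p : ℕ) : Set (ℂ → ℂ) :=
  {f | DifferentiableOn ℂ f disc ∧
    ∃ c : ℕ → ℂ, ∀ z ∈ disc, HasSum (fun k : ℕ => c k * z ^ (p + 1 + k)) (f z - z ^ p)}

/-- Subordination `g ≺ h`: `g = h ∘ ω` in the unit disc for some holomorphic self-map `ω` of the
disc with `ω 0 = 0`. -/
def Subordinate (g h : ℂ → ℂ) : Prop :=
  ∃ ω : ℂ → ℂ, DifferentiableOn ℂ ω disc ∧ Set.MapsTo ω disc disc ∧ ω 0 = 0 ∧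
    ∀ z ∈ disc, g z = h (ω z)

/-- The set of points `ζ` of the unit circle with `g z → ∞` as `z → ζ` inside the disc. -/
def excSet (g : ℂ → ℂ) : Set ℂ :=
  {ζ | ζ ∈ sphere (0 : ℂ) 1 ∧ Tendsto g (𝓝[disc] ζ) (Bornology.cobounded ℂ)}

/-- The class `Q`: functions on the disc which extend to a function that is analytic and injective
on the closed disc minus `excSet g`, and whose derivative is bounded away from zero on the unit
circle minus `excSet g`. -/
def classQ : Set (ℂ → ℂ) :=
  {g | ∃ G : ℂ → ℂ, Set.EqOn G g disc ∧
    AnalyticOnNhd ℂ G (closedBall (0 : ℂ) 1 \ excSet g) ∧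
    Set.InjOn G (closedBall (0 : ℂ) 1 \ excSet g) ∧
    ∃ ρ : ℝ, 0 < ρ ∧ ∀ ζ ∈ sphere (0 : ℂ) 1 \ excSet g, ρ ≤ ‖deriv G ζ‖}

open Classical in
/-- The holomorphic function in the unit disc which coincides with `g` in a punctured neighbourhood
of `0`, if there is one (it is unique on the disc, see `continuation_eqOn`). If there is none, the
value is `g` itself, which is then not holomorphic in the disc. -/
noncomputable def continuation (g : ℂ → ℂ) : ℂ → ℂ :=
  if h : ∃ G : ℂ → ℂ, DifferentiableOn ℂ G disc ∧ G =ᶠ[𝓝[≠] 0] g then h.choose else g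

theorem continuation_eqOn {g G : ℂ → ℂ} (hG : DifferentiableOn ℂ G disc)
    (h : G =ᶠ[𝓝[≠] 0] g) : Set.EqOn (continuation g) G disc := by
  have hex : ∃ G : ℂ → ℂ, DifferentiableOn ℂ G disc ∧ G =ᶠ[𝓝[≠] 0] g := ⟨G, hG, h⟩
  have hc : continuation g = hex.choose := by simp only [continuation, dif_pos hex]
  rw [hc]
  refine (hex.choose_spec.1.analyticOnNhd isOpen_ball).eqOn_of_preconnected_of_frequently_eq
    (hG.analyticOnNhd isOpen_ball) (convex_ball (0 : ℂ) 1).isPreconnected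
    (mem_ball_self one_pos) ?_
  exact (hex.choose_spec.2.trans h.symm).frequently

/-- The expression `(f' / (p z ^ (p - 1))) ^ η * (z ^ p / f) ^ μ` with principal powers. -/
noncomputable def powerProduct (p : ℕ) (η μ : ℂ) (f : ℂ → ℂ) (z : ℂ) : ℂ :=
  (deriv f z / ((p : ℂ) * z ^ (p - 1))) ^ η * (z ^ p / f z) ^ μ

/-- The operator `F_p^{η,μ}[f]`. For `f` in `A_p` both bases tend to `1` at the origin, so that the
principal powers are holomorphic near the origin, with the value `1` filled in at the origin itself;
`F_p^{η,μ}[f]` is the holomorphic function in the disc with this germ. It is equal to the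
expression with principal powers in the whole disc whenever the latter is holomorphic there, see
`diffOp_eqOn`. -/
noncomputable def diffOp (p : ℕ) (η μ : ℂ) (f : ℂ → ℂ) : ℂ → ℂ :=
  continuation (powerProduct p η μ f)

theorem diffOp_eqOn {p : ℕ} {η μ : ℂ} {f : ℂ → ℂ}
    (h : DifferentiableOn ℂ (Function.update (powerProduct p η μ f) 0 1) disc) :
    Set.EqOn (diffOp p η μ f) (Function.update (powerProduct p η μ f) 0 1) disc := by
  refine continuation_eqOn h ?_
  filter_upwards [self_mem_nhdsWithin] with z hz
  exact Function.update_of_ne hz _ _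

/-- The class `A_0` of all `f` in `A_p` with `F_p^{η,μ}[f](0) = 1`, where `(η, μ) ≠ (0, 0)`. -/
def classA0 (p : ℕ) (η μ : ℂ) : Set (ℂ → ℂ) :=
  {f | f ∈ classA p ∧ (η, μ) ≠ (0, 0) ∧ diffOp p η μ f 0 = 1}

/-- The expression
`(f' / (p z ^ (p - 1))) ^ η * (z ^ p / f) ^ μ *
  (σ + γ (η (1 - p + z f'' / f') + μ (p - z f' / f)))`. -/
noncomputable def psiExpr (p : ℕ) (η μ σ γ : ℂ) (f : ℂ → ℂ) (z : ℂ) : ℂ :=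
  (deriv f z / ((p : ℂ) * z ^ (p - 1))) ^ η * (z ^ p / f z) ^ μ *
    (σ + γ * (η * (1 - (p : ℂ) + z * deriv (deriv f) z / deriv f z) +
      μ * ((p : ℂ) - z * deriv f z / f z)))

/-- The function `Ψ`: the holomorphic function in the disc which is given near the origin by
`psiExpr`; this fills in the removable singularities at the zeros of `z`, `f` and `f'`. -/
noncomputable def Psi (p : ℕ) (η μ σ γ : ℂ) (f : ℂ → ℂ) : ℂ → ℂ :=
  continuation (psiExpr p η μ σ γ f)

/-- `g` satisfies the first-order differential superordination `h(z) ≺ φ(g(z), z g'(z); z)`, where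
`g` and `φ(g(z), z g'(z); z)` are univalent in the disc. -/
def SatisfiesSuperordination (φ : ℂ → ℂ → ℂ → ℂ) (h g : ℂ → ℂ) : Prop :=
  Univalent g ∧ Univalent (fun z => φ (g z) (z * deriv g z) z) ∧
    Subordinate h (fun z => φ (g z) (z * deriv g z) z)

/-- `r` is a subordinant of `h(z) ≺ φ(g(z), z g'(z); z)`: it is holomorphic in the disc and
subordinate to every `g` that satisfies the superordination. -/
def IsSubordinant (φ : ℂ → ℂ → ℂ → ℂ) (h r : ℂ → ℂ) : Prop :=
  DifferentiableOn ℂ r disc ∧ ∀ g : ℂ → ℂ, SatisfiesSuperordination φ h g → Subordinate r g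

/-- `q` is the best subordinant of the superordination `h(z) ≺ φ(g(z), z g'(z); z)` with univalent
`h`: a univalent subordinant to which every subordinant is subordinate. -/
def IsBestSubordinant (φ : ℂ → ℂ → ℂ → ℂ) (h q : ℂ → ℂ) : Prop :=
  Univalent h ∧ Univalent q ∧ IsSubordinant φ h q ∧
    ∀ r : ℂ → ℂ, IsSubordinant φ h r → Subordinate r q

end PValent

/-!
The result is about the linear superordination `σ q + γ z q' ≺ σ g + γ z g'`: near the origin
`F = F_p^{η,μ}[f]` has the logarithmic derivative that makes `Ψ = σ F + γ z F'`
(`eventuallyEq_psiExpr`, `eqOn_Psi`), and a function of the class `Q` is injective in the disc. So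
both `q ≺ F` and the statement that `q` is a subordinant follow from
`ConvexFunction.subordinate_of_superordination`: if `q` is convex, if `g` and
`P = σ g + γ z g'` are univalent, and if `h = σ q + γ z q' ≺ P`, then `q ≺ g`. No regularity of `g`
on the unit circle is needed. That `q` is the best subordinant is then immediate, since `g = q` is
admissible as soon as `h` is univalent.

Two facts about a convex `q` are used, with `c = σ / γ`. Both rest on the inequality
`Re (1 + z q'' / q') ≥ 0` (`ConvexFunction.re_one_add_nonneg`), which is derived from the convexity
of the image by Schwarz's lemma. First, `c q + z q'` is univalent
(`ConvexFunction.univalent_mul_add`), because as a function of `q` on the convex set `q(𝕌)` it has a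
derivative with positive real part. Secondly, every value `c q(z₀) + t z₀ q'(z₀)` with
`0 ≤ t ≤ 1` is a value of `c q + z q'` (`ConvexFunction.exists_mul_add_eq`), because
`c q + t z q'` is a subordination chain.

For the subordination it suffices that `q(𝕌) ⊆ g(𝕌)`. Otherwise take `z₁` of least modulus with
`q(z₁) ∉ g(𝕌)`, and put `ω = g⁻¹ ∘ q` on the disc of radius `‖z₁‖`. If `z` is a point where `‖ω‖` is
maximal on a smaller closed disc, then Jack's lemma (`exists_one_le_of_isMax_norm`) gives
`z ω'(z) = m ω(z)` with `m ≥ 1`, so that `P(ω(z)) = σ q(z) + γ z q'(z) / m`. As the smaller disc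
grows, a subsequence of these values converges to such a value at a point of `𝕌`, that is, to a
point of `h(𝕌) ⊆ P(𝕌)`. Since `P⁻¹` is continuous, the maximum of `‖ω‖` stays away from `1`, and
`q(z₁)` is a limit of values of `g` on a compact subset of the disc, hence a value of `g`.
-/

namespace PValent

/-! ### Univalent functions and their inverses -/

theorem Univalent.analyticAt {g : ℂ → ℂ} (hg : Univalent g) {z : ℂ} (hz : z ∈ disc) :
    AnalyticAt ℂ g z :=
  hg.1.analyticAt (isOpen_ball.mem_nhds hz)

theorem Univalent.not_eventually_const {g : ℂ → ℂ} (hg : Univalent g) {z : ℂ} (hz : z ∈ disc) :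
    ¬ ∀ᶠ w in 𝓝 z, g w = g z := by
  intro h
  have h' : ∀ᶠ w in 𝓝[≠] z, False := by
    filter_upwards [h.filter_mono nhdsWithin_le_nhds,
      (isOpen_ball.mem_nhds hz : disc ∈ 𝓝 z) |> mem_nhdsWithin_of_mem_nhds,
      self_mem_nhdsWithin] with w h1 h2 h3
    exact h3 (hg.2 h2 hz h1)
  exact (Filter.eventually_false_iff_eq_bot.1 h' ▸ (inferInstance : (𝓝[≠] z).NeBot)).ne rfl

theorem Univalent.image_mem_nhds {g : ℂ → ℂ} (hg : Univalent g) {z : ℂ} (hz : z ∈ disc)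
    {s : Set ℂ} (hs : s ∈ 𝓝 z) : g '' s ∈ 𝓝 (g z) :=
  (hg.analyticAt hz).eventually_constant_or_nhds_le_map_nhds.resolve_left
    (hg.not_eventually_const hz) (image_mem_map hs)

theorem Univalent.isOpen_image {g : ℂ → ℂ} (hg : Univalent g) : IsOpen (g '' disc) := by
  refine isOpen_iff_mem_nhds.2 ?_
  rintro _ ⟨z, hz, rfl⟩
  exact hg.image_mem_nhds hz (isOpen_ball.mem_nhds hz)

/-- The inverse of an injective function on the disc; only its values on `g '' disc` matter. -/
noncomputable def discInv (g : ℂ → ℂ) : ℂ → ℂ := Function.invFunOn g disc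

theorem Univalent.discInv_apply {g : ℂ → ℂ} (hg : Univalent g) {z : ℂ} (hz : z ∈ disc) :
    discInv g (g z) = z :=
  hg.2.leftInvOn_invFunOn hz

theorem discInv_mem {g : ℂ → ℂ} {w : ℂ} (hw : w ∈ g '' disc) : discInv g w ∈ disc :=
  Function.invFunOn_mem hw

theorem apply_discInv {g : ℂ → ℂ} {w : ℂ} (hw : w ∈ g '' disc) : g (discInv g w) = w :=
  Function.invFunOn_eq hw

theorem Univalent.continuousAt_discInv {g : ℂ → ℂ} (hg : Univalent g) {w : ℂ}
    (hw : w ∈ g '' disc) : ContinuousAt (discInv g) w := by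
  obtain ⟨z, hz, rfl⟩ := hw
  rw [ContinuousAt, hg.discInv_apply hz]
  intro s hs
  have hs' : s ∩ disc ∈ 𝓝 z := inter_mem hs (isOpen_ball.mem_nhds hz)
  rw [mem_map]
  refine mem_of_superset (hg.image_mem_nhds hz hs') ?_
  rintro _ ⟨x, hx, rfl⟩
  simpa [hg.discInv_apply hx.2] using hx.1

/-- The inverse is continuous, and differentiable off the discrete set of critical values, so that
the critical values are removable singularities. -/
theorem Univalent.analyticAt_discInv {g : ℂ → ℂ} (hg : Univalent g) {w : ℂ}
    (hw : w ∈ g '' disc) : AnalyticAt ℂ (discInv g) w := by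
  obtain ⟨z, hz, rfl⟩ := hw
  refine Complex.analyticAt_of_differentiable_on_punctured_nhds_of_continuousAt ?_
    (hg.continuousAt_discInv ⟨z, hz, rfl⟩)
  have hne : ∀ᶠ x in 𝓝[≠] z, deriv g x ≠ 0 := by
    -- otherwise `g'` vanishes around `z`, and `g` is constant there
    refine ((hg.analyticAt hz).deriv.eventually_eq_zero_or_eventually_ne_zero).resolve_left ?_
    intro h0
    obtain ⟨ε, hε, hball⟩ := Metric.eventually_nhds_iff_ball.1
      (h0.and (isOpen_ball.mem_nhds hz : ∀ᶠ x in 𝓝 z, x ∈ disc))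
    refine hg.not_eventually_const hz ?_
    filter_upwards [ball_mem_nhds z hε] with x hx
    exact isOpen_ball.is_const_of_deriv_eq_zero (convex_ball z ε).isPreconnected
      (fun y hy => (hg.analyticAt (hball y hy).2).differentiableAt.differentiableWithinAt)
      (fun y hy => (hball y hy).1) hx (mem_ball_self hε)
  have hinv : Tendsto (discInv g) (𝓝[≠] (g z)) (𝓝[≠] z) := by
    refine tendsto_nhdsWithin_iff.2 ⟨?_, ?_⟩
    · have := (hg.continuousAt_discInv ⟨z, hz, rfl⟩).tendsto
      rw [hg.discInv_apply hz] at this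
      exact this.mono_left nhdsWithin_le_nhds
    · filter_upwards [mem_nhdsWithin_of_mem_nhds (hg.isOpen_image.mem_nhds ⟨z, hz, rfl⟩),
        self_mem_nhdsWithin] with w hw hne h
      exact hne (by rw [← apply_discInv hw, h]; rfl)
  filter_upwards [hinv.eventually hne,
    mem_nhdsWithin_of_mem_nhds (hg.isOpen_image.mem_nhds ⟨z, hz, rfl⟩)] with w h1 h2
  exact (HasDerivAt.of_local_left_inverse (hg.continuousAt_discInv h2)
    (hg.analyticAt (discInv_mem h2)).differentiableAt.hasDerivAt h1
    (by filter_upwards [hg.isOpen_image.mem_nhds h2] with y hy using apply_discInv hy)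
    ).differentiableAt

/-- The chain rule for `g⁻¹ ∘ g`, the inverse being differentiable at every value of `g`. -/
theorem Univalent.deriv_ne_zero {g : ℂ → ℂ} (hg : Univalent g) {z : ℂ} (hz : z ∈ disc) :
    deriv g z ≠ 0 := by
  have h1 := (hg.analyticAt_discInv ⟨z, hz, rfl⟩).differentiableAt.hasDerivAt.comp z
    (hg.analyticAt hz).differentiableAt.hasDerivAt
  have h2 : HasDerivAt (discInv g ∘ g) 1 z := by
    refine (hasDerivAt_id z).congr_of_eventuallyEq ?_
    filter_upwards [isOpen_ball.mem_nhds hz] with x hx using hg.discInv_apply hx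
  intro h
  simpa [h] using h1.unique h2

theorem Univalent.hasDerivAt_discInv {g : ℂ → ℂ} (hg : Univalent g) {z : ℂ} (hz : z ∈ disc) :
    HasDerivAt (discInv g) (deriv g z)⁻¹ (g z) := by
  refine HasDerivAt.of_local_left_inverse (f := g) (hg.continuousAt_discInv ⟨z, hz, rfl⟩) ?_
    (hg.deriv_ne_zero hz) ?_
  · rw [hg.discInv_apply hz]; exact (hg.analyticAt hz).differentiableAt.hasDerivAt
  · filter_upwards [hg.isOpen_image.mem_nhds ⟨z, hz, rfl⟩] with y hy using apply_discInv hy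

/-- Subordination to a univalent function amounts to inclusion of the images. -/
theorem Univalent.subordinate_of_image_subset {q g : ℂ → ℂ} (hg : Univalent g)
    (hq : DifferentiableOn ℂ q disc) (h0 : q 0 = g 0) (h : Set.MapsTo q disc (g '' disc)) :
    Subordinate q g := by
  refine ⟨discInv g ∘ q, fun z hz => ?_, fun z hz => discInv_mem (h hz), ?_,
    fun z hz => (apply_discInv (h hz)).symm⟩
  · exact ((hg.analyticAt_discInv (h hz)).differentiableAt.comp z
      (hq.differentiableAt (isOpen_ball.mem_nhds hz))).differentiableWithinAt
  · simp [h0, hg.discInv_apply (mem_ball_self one_pos)]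

theorem Univalent.congr {g h : ℂ → ℂ} (hg : Univalent g) (hh : Set.EqOn h g disc) :
    Univalent h :=
  ⟨hg.1.congr hh, hh.symm.injOn_iff.1 hg.2⟩

theorem Subordinate.refl (g : ℂ → ℂ) : Subordinate g g :=
  ⟨id, differentiableOn_id, Set.mapsTo_id _, rfl, fun _ _ => rfl⟩

theorem Subordinate.congr_right {g h k : ℂ → ℂ} (hg : Subordinate g h)
    (hk : Set.EqOn h k disc) : Subordinate g k := by
  obtain ⟨ω, h1, h2, h3, h4⟩ := hg
  exact ⟨ω, h1, h2, h3, fun z hz => (h4 z hz).trans (hk (h2 hz))⟩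

/-! ### Convex functions -/

theorem deriv_nonpos_of_eventually_le {f : ℝ → ℝ} {f' a : ℝ} (hf : HasDerivAt f f' a)
    (h : ∀ᶠ x in 𝓝[>] a, f x ≤ f a) : f' ≤ 0 := by
  have hs : Tendsto (slope f a) (𝓝[>] a) (𝓝 f') :=
    (hasDerivAt_iff_tendsto_slope.1 hf).mono_left (nhdsWithin_mono _ fun x hx => ne_of_gt hx)
  refine le_of_tendsto hs ?_
  filter_upwards [h, self_mem_nhdsWithin] with x hx hxa
  rw [slope_def_field]
  exact div_nonpos_of_nonpos_of_nonneg (sub_nonpos.2 hx) (sub_nonneg.2 (le_of_lt hxa))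

theorem deriv_deriv_nonneg_of_isLocalMin {f : ℝ → ℝ} {a : ℝ} (h : IsLocalMin f a)
    (hc : ContinuousAt f a) : 0 ≤ deriv (deriv f) a := by
  by_contra! hneg
  have hmax : IsLocalMax f a := isLocalMax_of_deriv_deriv_neg hneg h.deriv_eq_zero hc
  -- a point that is both a local minimum and a local maximum has constant values around it
  have hconst : f =ᶠ[𝓝 a] fun _ => f a := by
    filter_upwards [h, hmax] with x h1 h2 using le_antisymm h2 h1
  have hd := hconst.deriv.deriv_eq
  simp at hd
  exact hneg.ne hd

/-- By Schwarz's lemma, `(1 - ε) q(x) + ε q(ax)` with `‖a‖ ≤ 1` takes values in `q` of the closed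
disc of radius `‖x‖`; the inequality is the derivative of this fact at `ε = 0`. -/
theorem ConvexFunction.re_sub_div_nonneg {q : ℂ → ℂ} (hq : ConvexFunction q) {z z' : ℂ}
    (hz : z ∈ disc) (hz0 : z ≠ 0) (hle : ‖z'‖ ≤ ‖z‖) :
    0 ≤ ((q z - q z') / (z * deriv q z)).re := by
  have hU := hq.1
  have hz1 : ‖z‖ < 1 := by simpa using hz
  set a := z' / z with ha
  have haz : a * z = z' := by rw [ha]; field_simp
  have ha1 : ‖a‖ ≤ 1 := by
    rw [ha, norm_div]; exact div_le_one_of_le₀ hle (norm_nonneg _)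
  have hamem : ∀ x ∈ disc, a * x ∈ disc := by
    intro x hx
    have hx1 : ‖x‖ < 1 := by simpa using hx
    have : ‖a * x‖ < 1 := by
      rw [norm_mul]
      exact lt_of_le_of_lt (mul_le_of_le_one_left (norm_nonneg _) ha1) hx1
    simpa using this
  have hcomb : ∀ ε ∈ Set.Icc (0 : ℝ) 1, ∀ x ∈ disc,
      (1 - ε : ℂ) * q x + ε * q (a * x) ∈ q '' disc := by
    intro ε hε x hx
    have := hq.2 (Set.mem_image_of_mem q hx) (Set.mem_image_of_mem q (hamem x hx))
      (sub_nonneg.2 hε.2) hε.1 (by ring)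
    simpa [Complex.real_smul] using this
  have hschwarz : ∀ ε ∈ Set.Icc (0 : ℝ) 1,
      ‖discInv q ((1 - ε : ℂ) * q z + ε * q (a * z))‖ ≤ ‖z‖ := by
    intro ε hε
    have hd : DifferentiableOn ℂ (fun x => discInv q ((1 - ε : ℂ) * q x + ε * q (a * x)))
        (ball 0 1) := by
      intro x hx
      refine DifferentiableAt.differentiableWithinAt ?_
      have h1 := (hU.analyticAt hx).differentiableAt
      have h2 : DifferentiableAt ℂ (fun x => q (a * x)) x :=
        (hU.analyticAt (hamem x hx)).differentiableAt.comp x (by fun_prop)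
      exact DifferentiableAt.comp x (g := discInv q)
        (hU.analyticAt_discInv (hcomb ε hε x hx)).differentiableAt
        ((h1.const_mul _).add (h2.const_mul _))
    refine Complex.norm_le_norm_of_mapsTo_ball (R := 1) hd
      (fun x hx => ball_subset_closedBall (discInv_mem (hcomb ε hε x hx))) ?_ hz1
    have : (1 - ε : ℂ) * q 0 + ε * q (a * 0) = q 0 := by simp; ring
    rw [this, hU.discInv_apply (mem_ball_self one_pos)]
  have hderiv : HasDerivAt
      (fun ε : ℝ => (discInv q ((1 - ε : ℂ) * q z + ε * q (a * z)) / z).re)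
      (((deriv q z)⁻¹ * (q z' - q z) / z).re) 0 := by
    have hlin : HasDerivAt (fun ε : ℂ => (1 - ε) * q z + ε * q (a * z)) (q z' - q z)
        ((0 : ℝ) : ℂ) := by
      rw [haz]
      have h1 := (((hasDerivAt_id ((0 : ℝ) : ℂ)).const_sub 1).mul_const (q z)).add
        ((hasDerivAt_id ((0 : ℝ) : ℂ)).mul_const (q z'))
      convert! h1 using 1
      ring
    have hinv : HasDerivAt (discInv q) (deriv q z)⁻¹
        ((1 - ((0 : ℝ) : ℂ)) * q z + ((0 : ℝ) : ℂ) * q (a * z)) := by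
      simpa using hU.hasDerivAt_discInv hz
    exact ((hinv.comp ((0 : ℝ) : ℂ) (h := fun ε : ℂ => (1 - ε) * q z + ε * q (a * z)) hlin).div_const
      z).real_of_complex
  have hle0 := deriv_nonpos_of_eventually_le hderiv (by
    filter_upwards [Ioc_mem_nhdsGT (zero_lt_one' ℝ)] with ε hε
    have h0 : discInv q ((1 - ((0 : ℝ) : ℂ)) * q z + ((0 : ℝ) : ℂ) * q (a * z)) / z = 1 := by
      simp [hU.discInv_apply hz, hz0]
    rw [h0, Complex.one_re]
    refine (Complex.re_le_norm _).trans ?_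
    rw [norm_div]
    exact div_le_one_of_le₀ (hschwarz ε ⟨hε.1.le, hε.2⟩) (norm_nonneg _))
  have heq : (q z - q z') / (z * deriv q z) = -((deriv q z)⁻¹ * (q z' - q z) / z) := by
    have := hU.deriv_ne_zero hz
    field_simp
    ring
  rw [heq, Complex.neg_re]
  linarith

/-- The analytic form of convexity, obtained from the second derivative in `θ` of the nonnegative
function `Re ((q(z) - q(z e^{iθ})) / (z q'(z)))`, which vanishes at `θ = 0`. -/
theorem ConvexFunction.re_one_add_nonneg {q : ℂ → ℂ} (hq : ConvexFunction q) {z : ℂ}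
    (hz : z ∈ disc) : 0 ≤ (1 + z * deriv (deriv q) z / deriv q z).re := by
  rcases eq_or_ne z 0 with rfl | hz0
  · simp
  have hU := hq.1
  have hd0 := hU.deriv_ne_zero hz
  set e : ℝ → ℂ := fun θ => z * Complex.exp (θ * Complex.I) with he
  have hen : ∀ θ, ‖e θ‖ = ‖z‖ := fun θ => by
    simp only [he]; rw [norm_mul, Complex.norm_exp_ofReal_mul_I, mul_one]
  have hemem : ∀ θ, e θ ∈ disc := fun θ => by
    have hz1 : ‖z‖ < 1 := by simpa using hz
    simpa using (hen θ).trans_lt hz1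
  have hed : ∀ θ, HasDerivAt e (e θ * Complex.I) θ := by
    intro θ
    have h1 : HasDerivAt (fun x : ℂ => z * Complex.exp (x * Complex.I))
        (z * (Complex.exp (θ * Complex.I) * (1 * Complex.I))) (θ : ℂ) :=
      (((hasDerivAt_id (θ : ℂ)).mul_const Complex.I).cexp).const_mul z
    convert! h1.comp_ofReal using 1
    simp only [he]; ring
  have hre : ∀ {u : ℝ → ℂ} {u' : ℂ} {θ : ℝ}, HasDerivAt u u' θ →
      HasDerivAt (fun t => (u t).re) u'.re θ := fun h =>
    (Complex.reCLM.hasFDerivAt.comp_hasDerivAt _ h)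
  set φ : ℝ → ℝ := fun θ => ((q z - q (e θ)) / (z * deriv q z)).re with hφ
  have hφ1 : ∀ θ, HasDerivAt φ
      ((-(deriv q (e θ) * (e θ * Complex.I)) / (z * deriv q z)).re) θ := by
    intro θ
    have h1 : HasDerivAt (fun t => q (e t)) (deriv q (e θ) * (e θ * Complex.I)) θ :=
      (hU.analyticAt (hemem θ)).differentiableAt.hasDerivAt.comp θ (hed θ)
    exact hre ((h1.const_sub (q z)).div_const _)
  have he0 : e 0 = z := by simp [he]
  have hφ2 : HasDerivAt (deriv φ)
      ((1 + z * deriv (deriv q) z / deriv q z).re) 0 := by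
    have h1 : HasDerivAt (fun t => deriv q (e t)) (deriv (deriv q) (e 0) * (e 0 * Complex.I)) 0 :=
      (hU.analyticAt (hemem 0)).deriv.differentiableAt.hasDerivAt.comp 0 (hed 0)
    have h2 := hre (((h1.mul ((hed 0).mul_const Complex.I)).neg).div_const (z * deriv q z))
    have h3 : deriv φ = fun θ =>
        ((-(deriv q (e θ) * (e θ * Complex.I)) / (z * deriv q z)).re) :=
      funext fun θ => (hφ1 θ).deriv
    rw [h3]
    convert! h2 using 2
    rw [he0]
    field_simp
    ring_nf
    simp [Complex.I_sq]
  have hmin : IsLocalMin φ 0 := by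
    refine Filter.Eventually.of_forall fun θ => ?_
    have h0 : φ 0 = 0 := by simp [hφ, he0]
    rw [h0]
    exact hq.re_sub_div_nonneg hz hz0 (hen θ).le
  rw [← hφ2.deriv]
  exact deriv_deriv_nonneg_of_isLocalMin hmin (hφ1 0).continuousAt

/-! ### The function `c q + z q'` for convex `q` -/

/-- The Noshiro–Warschawski criterion: on the segment from `a` to `b` the real part of
`H / (b - a)` has positive derivative. -/
theorem injOn_of_re_deriv_pos {D : Set ℂ} (hD : Convex ℝ D) {H H' : ℂ → ℂ}
    (hH : ∀ w ∈ D, HasDerivAt H (H' w) w) (hpos : ∀ w ∈ D, 0 < (H' w).re) : Set.InjOn H D := by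
  intro a ha b hb hab
  by_contra hne
  have hba : b - a ≠ 0 := sub_ne_zero.2 (Ne.symm hne)
  have hmem : ∀ t ∈ Set.Icc (0 : ℝ) 1, a + t * (b - a) ∈ D := by
    intro t ht
    have := hD.add_smul_sub_mem ha hb ht
    simpa [Complex.real_smul] using this
  have hder : ∀ t ∈ Set.Icc (0 : ℝ) 1,
      HasDerivAt (fun t : ℝ => (H (a + t * (b - a)) / (b - a)).re) (H' (a + t * (b - a))).re t := by
    intro t ht
    have h1 : HasDerivAt (fun s : ℂ => a + s * (b - a)) (b - a) (t : ℂ) := by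
      simpa using ((hasDerivAt_id (t : ℂ)).mul_const (b - a)).const_add a
    have h2 := ((hH _ (hmem t ht)).comp (t : ℂ) (h := fun s : ℂ => a + s * (b - a)) h1).div_const
      (b - a)
    rw [mul_div_cancel_right₀ _ hba] at h2
    exact h2.real_of_complex
  have hmono := strictMonoOn_of_deriv_pos (convex_Icc (0 : ℝ) 1)
    (fun t ht => (hder t ht).continuousAt.continuousWithinAt)
    (fun t ht => by
      rw [interior_Icc] at ht
      rw [(hder t (Set.Ioo_subset_Icc_self ht)).deriv]
      exact hpos _ (hmem t (Set.Ioo_subset_Icc_self ht)))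
  have := hmono (Set.left_mem_Icc.2 zero_le_one) (Set.right_mem_Icc.2 zero_le_one) zero_lt_one
  simp [hab] at this

theorem Univalent.const_mul {g : ℂ → ℂ} (hg : Univalent g) {a : ℂ} (ha : a ≠ 0) :
    Univalent (fun z => a * g z) :=
  ⟨hg.1.const_mul a, fun _ hx _ hy h => hg.2 hx hy (mul_left_cancel₀ ha h)⟩

theorem Univalent.hasDerivAt_mul_add {q : ℂ → ℂ} (hq : Univalent q) (c s : ℂ) {z : ℂ}
    (hz : z ∈ disc) :
    HasDerivAt (fun z => c * q z + s * (z * deriv q z))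
      (deriv q z * (c + s * (1 + z * deriv (deriv q) z / deriv q z))) z := by
  have h1 := (hq.analyticAt hz).differentiableAt.hasDerivAt
  have h2 := (hq.analyticAt hz).deriv.differentiableAt.hasDerivAt
  have := hq.deriv_ne_zero hz
  convert! (h1.const_mul c).add (((hasDerivAt_id z).mul h2).const_mul s) using 1
  simp only [id]
  field_simp

/-- `c q + z q'` is a function of `q` on the convex set `q(𝕌)`, and the derivative
`c + 1 + z q'' / q'` of that function has positive real part. -/
theorem ConvexFunction.univalent_mul_add {q : ℂ → ℂ} (hq : ConvexFunction q) {c : ℂ}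
    (hc : 0 < c.re) : Univalent (fun z => c * q z + z * deriv q z) := by
  have hU := hq.1
  have hd : ∀ z ∈ disc, HasDerivAt (fun z => c * q z + z * deriv q z)
      (deriv q z * (c + (1 + z * deriv (deriv q) z / deriv q z))) z := fun z hz => by
    simpa only [one_mul] using hU.hasDerivAt_mul_add c 1 hz
  refine ⟨fun z hz => (hd z hz).differentiableAt.differentiableWithinAt, ?_⟩
  have hinj : Set.InjOn ((fun z => c * q z + z * deriv q z) ∘ discInv q) (q '' disc) := by
    refine injOn_of_re_deriv_pos hq.2 (H' := fun w => c + (1 + discInv q w *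
      deriv (deriv q) (discInv q w) / deriv q (discInv q w))) ?_ ?_
    · rintro _ ⟨z, hz, rfl⟩
      have h1 := hd z hz
      rw [← hU.discInv_apply hz] at h1
      have h2 := h1.comp (q z) (hU.hasDerivAt_discInv hz)
      rw [hU.discInv_apply hz] at h2 ⊢
      convert! h2 using 1
      rw [mul_right_comm, mul_inv_cancel₀ (hU.deriv_ne_zero hz), one_mul]
    · rintro _ ⟨z, hz, rfl⟩
      rw [hU.discInv_apply hz, Complex.add_re]
      exact add_pos_of_pos_of_nonneg hc (hq.re_one_add_nonneg hz)
  intro x hx y hy hxy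
  refine hU.2 hx hy (hinj ⟨x, hx, rfl⟩ ⟨y, hy, rfl⟩ ?_)
  simpa [hU.discInv_apply hx, hU.discInv_apply hy] using hxy

/-- The family `c q + t z q'` is a subordination chain: its images increase with `t`. A solution
`(z, s)` of `c q(z) + s z q'(z) = w` with `s < 1` is continued to a larger `s`, inside the same
closed disc, by inverting `T(z) = (w - c q(z)) / (z q'(z))`, whose value at a solution is `s`: along
the solution curve the logarithmic derivative of `z` in `s` is `-1 / (c + s (1 + z q'' / q'))`, which
has negative real part, so that `‖z‖` decreases. -/
theorem ConvexFunction.exists_mul_add_eq {q : ℂ → ℂ} (hq : ConvexFunction q) {c : ℂ}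
    (hc : 0 < c.re) {z₀ : ℂ} (hz₀ : z₀ ∈ disc) {t : ℝ} (ht : t ∈ Set.Icc (0 : ℝ) 1) :
    ∃ z ∈ disc, c * q z + z * deriv q z = c * q z₀ + t * (z₀ * deriv q z₀) := by
  have hU := hq.1
  set w := c * q z₀ + t * (z₀ * deriv q z₀) with hw
  have hz₀1 : ‖z₀‖ < 1 := by simpa using hz₀
  have hsub : closedBall (0 : ℂ) ‖z₀‖ ⊆ disc := closedBall_subset_ball hz₀1
  set K : Set (ℂ × ℝ) := (closedBall (0 : ℂ) ‖z₀‖ ×ˢ Set.Icc t 1) ∩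
    (fun x : ℂ × ℝ => c * q x.1 + x.2 * (x.1 * deriv q x.1)) ⁻¹' {w} with hK
  have hKc : IsCompact K := by
    have hprod : IsCompact (closedBall (0 : ℂ) ‖z₀‖ ×ˢ Set.Icc t 1) :=
      (isCompact_closedBall _ _).prod isCompact_Icc
    refine hprod.of_isClosed_subset ?_ Set.inter_subset_left
    refine ContinuousOn.preimage_isClosed_of_isClosed ?_ hprod.isClosed isClosed_singleton
    intro x hx
    have h1 : ContinuousAt (fun x : ℂ × ℝ => q x.1) x :=
      (hU.analyticAt (hsub hx.1)).continuousAt.comp continuousAt_fst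
    have h2 : ContinuousAt (fun x : ℂ × ℝ => deriv q x.1) x :=
      (hU.analyticAt (hsub hx.1)).deriv.continuousAt.comp continuousAt_fst
    have h3 : ContinuousAt (fun x : ℂ × ℝ => (x.2 : ℂ)) x :=
      (Complex.continuous_ofReal.comp continuous_snd).continuousAt
    exact ((continuousAt_const.mul h1).add
      (h3.mul (continuousAt_fst.mul h2))).continuousWithinAt
  have hKn : K.Nonempty := ⟨(z₀, t), ⟨by simp, by simp [ht.2]⟩, by simp [hw]⟩
  -- a solution with the largest `s`; it has to be shown that `s = 1`
  obtain ⟨⟨z, s⟩, ⟨⟨hzK, hsK⟩, hzs⟩, hmax⟩ := hKc.exists_isMaxOn hKn continuous_snd.continuousOn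
  simp only [Set.mem_preimage, Set.mem_singleton_iff] at hzK hsK hzs
  have hmax' : ∀ z' s', ‖z'‖ ≤ ‖z₀‖ → s' ∈ Set.Icc t 1 →
      c * q z' + s' * (z' * deriv q z') = w → s' ≤ s := fun z' s' h1 h2 h3 =>
    hmax (show (z', s') ∈ K from ⟨⟨by simpa using h1, h2⟩, h3⟩)
  have hz := hsub hzK
  refine ⟨z, hz, ?_⟩
  rcases hsK.2.eq_or_lt with rfl | hs1
  · simpa using hzs
  exfalso
  rcases eq_or_ne z 0 with rfl | hz0
  · -- at `z = 0` the equation does not depend on `s`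
    exact absurd (hmax' 0 1 (by simp) ⟨ht.2, le_rfl⟩ (by simpa using hzs)) (not_le.2 hs1)
  have hd0 := hU.deriv_ne_zero hz
  have hden : z * deriv q z ≠ 0 := mul_ne_zero hz0 hd0
  set J := 1 + z * deriv (deriv q) z / deriv q z with hJ
  have hJre : 0 < (c + s * J).re := by
    have := hq.re_one_add_nonneg hz
    simp only [Complex.add_re, Complex.re_ofReal_mul] at this ⊢
    have h2 : 0 ≤ s * J.re := mul_nonneg (ht.1.trans hsK.1) (by simpa [hJ] using this)
    linarith
  have hE0 : c + s * J ≠ 0 := fun h => by simp [h] at hJre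
  set T : ℂ → ℂ := fun x => (w - c * q x) / (x * deriv q x) with hT
  have hTz : T z = s := by
    simp only [hT]; rw [div_eq_iff hden, ← hzs]; ring
  have hTd : HasStrictDerivAt T (-(c + s * J) / z) z := by
    have h1 := (hU.analyticAt hz).hasStrictDerivAt
    have h2 := (hU.analyticAt hz).deriv.hasStrictDerivAt
    have h3 := ((h1.const_mul c).const_sub w).div ((hasStrictDerivAt_id z).mul h2) hden
    convert! h3 using 1
    have hw' : w - c * q z = s * (z * deriv q z) := by rw [← hzs]; ring
    simp only [Pi.mul_apply, id]
    rw [hw', hJ]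
    field_simp
    ring
  have hT0 : -(c + s * J) / z ≠ 0 := div_ne_zero (neg_ne_zero.2 hE0) hz0
  set Z := hTd.localInverse T _ z hT0 with hZ
  have hZs : Z s = z := by
    have := (hTd.eventually_left_inverse hT0).self_of_nhds
    rwa [hTz] at this
  have hZd : HasDerivAt Z (-(c + s * J) / z)⁻¹ (s : ℂ) := by
    have := (hTd.to_localInverse hT0).hasDerivAt
    rwa [hTz] at this
  have hZr : HasDerivAt (fun x : ℝ => Z x) (-(c + s * J) / z)⁻¹ s := hZd.comp_ofReal
  -- the modulus of the solution decreases in `s`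
  have hnorm : HasDerivAt (fun x : ℝ => ‖Z x‖ ^ 2) (2 * inner ℝ (Z s) (-(c + s * J) / z)⁻¹) s :=
    hZr.norm_sq
  have hneg : 2 * inner ℝ (Z s) (-(c + s * J) / z)⁻¹ < 0 := by
    rw [hZs, Complex.inner, mul_comm _ ((starRingEnd ℂ) z)]
    have h1 : (starRingEnd ℂ) z * (-(c + s * J) / z)⁻¹
        = ((-Complex.normSq z : ℝ) : ℂ) * (c + s * J)⁻¹ := by
      rw [Complex.ofReal_neg, Complex.normSq_eq_conj_mul_self, inv_div, div_neg]
      ring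
    have h2 : 0 < ((c + s * J)⁻¹).re := by
      rw [Complex.inv_re]
      exact div_pos hJre (Complex.normSq_pos.2 hE0)
    rw [h1, Complex.re_ofReal_mul]
    nlinarith [mul_pos (Complex.normSq_pos.2 hz0) h2]
  have hlt : ∀ᶠ x : ℝ in 𝓝[>] s, ‖Z x‖ ^ 2 < ‖Z s‖ ^ 2 := by
    have hs : Tendsto (slope (fun x : ℝ => ‖Z x‖ ^ 2) s) (𝓝[>] s) (𝓝 _) :=
      (hasDerivAt_iff_tendsto_slope.1 hnorm).mono_left (nhdsWithin_mono _ fun x hx => ne_of_gt hx)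
    filter_upwards [hs.eventually_lt_const hneg, self_mem_nhdsWithin] with x hx hxs
    rw [slope_def_field, div_neg_iff] at hx
    have : 0 < x - s := sub_pos.2 hxs
    rcases hx with h | h <;> linarith [h.1, h.2]
  have hright : ∀ᶠ x : ℝ in 𝓝 s, T (Z x) = x := by
    have h := hTd.eventually_right_inverse hT0
    rw [hTz] at h
    exact Complex.continuous_ofReal.continuousAt.eventually h
  have hnear : ∀ᶠ x : ℝ in 𝓝 s, Z x * deriv q (Z x) ≠ 0 := by
    have h1 : ContinuousAt (fun x : ℝ => Z x * deriv q (Z x)) s := by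
      refine hZr.continuousAt.mul ?_
      refine ContinuousAt.comp (g := deriv q) ?_ hZr.continuousAt
      rw [hZs]
      exact (hU.analyticAt hz).deriv.continuousAt
    exact h1.eventually_ne (by rwa [hZs])
  obtain ⟨x, ⟨hx1, hx2, hx3⟩, hx4⟩ := ((hlt.and
    ((hright.filter_mono nhdsWithin_le_nhds).and (hnear.filter_mono nhdsWithin_le_nhds))).and
    (Ioc_mem_nhdsGT hs1)).exists
  have hxz : ‖Z x‖ ≤ ‖z₀‖ := by
    rw [hZs] at hx1
    have h1 := lt_of_pow_lt_pow_left₀ 2 (norm_nonneg z) hx1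
    exact h1.le.trans (by simpa using hzK)
  refine absurd (hmax' (Z x) x hxz ⟨hsK.1.trans hx4.1.le, hx4.2⟩ ?_) (not_le.2 hx4.1)
  simp only [hT] at hx2
  rw [div_eq_iff hx3] at hx2
  rw [← hx2]
  ring

/-! ### Jack's lemma -/

/-- **Jack's lemma**: at a point where `‖ω‖` is maximal on the closed disc through that point, the
quotient `z ω' / ω` is real and at least `1`. -/
theorem exists_one_le_of_isMax_norm {ω : ℂ → ℂ} {R : ℝ} (hω : DifferentiableOn ℂ ω (ball 0 R))
    (h0 : ω 0 = 0) {z : ℂ} (hz : z ∈ ball (0 : ℂ) R) (hωz : ω z ≠ 0)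
    (hmax : ∀ x, ‖x‖ ≤ ‖z‖ → ‖ω x‖ ≤ ‖ω z‖) :
    ∃ m : ℝ, 1 ≤ m ∧ z * deriv ω z = m * ω z := by
  have hz0 : z ≠ 0 := fun h => hωz (h ▸ h0)
  have hzR : ‖z‖ < R := by simpa using hz
  have hzpos : 0 < ‖z‖ := norm_pos_iff.2 hz0
  set M := z * deriv ω z / ω z with hM
  -- Schwarz's lemma on the disc of radius `‖z‖`
  have hschwarz : ∀ a : ℂ, ‖a‖ < 1 → ‖ω (a * z)‖ ≤ ‖a‖ * ‖ω z‖ := by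
    intro a ha
    have haz : a * z ∈ ball (0 : ℂ) ‖z‖ := by
      simpa using mul_lt_of_lt_one_left hzpos ha
    have h1 := Complex.dist_le_div_mul_dist_of_mapsTo_ball (f := ω) (c := 0) (R₁ := ‖z‖)
      (R₂ := ‖ω z‖) (hω.mono (ball_subset_ball hzR.le))
      (fun x hx => by
        have : ‖x‖ < ‖z‖ := by simpa using hx
        simpa [h0] using hmax x this.le) haz
    rw [h0, dist_zero_right, dist_zero_right, norm_mul] at h1
    calc _ ≤ _ := h1
      _ = _ := by field_simp
  -- differentiate Schwarz's lemma at `z` in the inward direction `-u z`, with the polynomial bound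
  -- `(1 + ‖1 - ε u‖ ^ 2) / 2` in place of `‖1 - ε u‖`
  have hdir : ∀ u : ℂ, 0 < u.re → 0 ≤ (u * (M - 1)).re := by
    intro u hu
    have hsq : ∀ ε : ℝ, ‖1 - ε * u‖ ^ 2 = 1 - 2 * ε * u.re + ε ^ 2 * ‖u‖ ^ 2 := by
      intro ε
      rw [← Complex.normSq_eq_norm_sq, ← Complex.normSq_eq_norm_sq, Complex.normSq_apply,
        Complex.normSq_apply]
      simp
      ring
    have hder : HasDerivAt (fun ε : ℝ => (ω ((1 - ε * u) * z) / ω z).re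
        - (1 + (1 - 2 * ε * u.re + ε ^ 2 * ‖u‖ ^ 2)) / 2) (-(u * (M - 1)).re) 0 := by
      have h1 : HasDerivAt (fun ε : ℂ => (1 - ε * u) * z) (-u * z) ((0 : ℝ) : ℂ) := by
        simpa using (((hasDerivAt_id ((0 : ℝ) : ℂ)).mul_const u).const_sub 1).mul_const z
      have h2 : HasDerivAt ω (deriv ω z) ((1 - ((0 : ℝ) : ℂ) * u) * z) := by
        simpa using (hω.differentiableAt (isOpen_ball.mem_nhds hz)).hasDerivAt
      have h3 := ((h2.comp ((0 : ℝ) : ℂ) (h := fun ε : ℂ => (1 - ε * u) * z) h1).div_const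
        (ω z)).real_of_complex
      have h4 : HasDerivAt (fun ε : ℝ => (1 + (1 - 2 * ε * u.re + ε ^ 2 * ‖u‖ ^ 2)) / 2)
          (-u.re) 0 := by
        have := (((((((hasDerivAt_id (0 : ℝ)).const_mul 2).mul_const u.re).const_sub 1).add
          (((hasDerivAt_id (0 : ℝ)).pow 2).mul_const (‖u‖ ^ 2))).const_add 1).div_const 2)
        convert! this using 1
        simp
        ring
      convert! h3.sub h4 using 1
      have : deriv ω z * (-u * z) / ω z = -(u * M) := by rw [hM]; ring
      rw [this]
      simp only [mul_sub, mul_one, Complex.sub_re, Complex.neg_re]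
      ring
    have hle := deriv_nonpos_of_eventually_le hder (by
      have hsmall : ∀ᶠ ε : ℝ in 𝓝[>] 0, ε * ‖u‖ ^ 2 < 2 * u.re := by
        have : ContinuousAt (fun ε : ℝ => ε * ‖u‖ ^ 2) 0 := by fun_prop
        exact (this.eventually_lt continuousAt_const (by simpa using hu)).filter_mono
          nhdsWithin_le_nhds
      filter_upwards [hsmall, self_mem_nhdsWithin] with ε hε hε0
      have hε0 : 0 < ε := hε0
      have hlt : ‖1 - ε * u‖ < 1 := by
        have : ‖1 - ε * u‖ ^ 2 < 1 ^ 2 := by rw [hsq]; nlinarith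
        exact lt_of_pow_lt_pow_left₀ 2 zero_le_one this
      have h1 : (ω ((1 - ε * u) * z) / ω z).re ≤ ‖1 - ε * u‖ := by
        refine (Complex.re_le_norm _).trans ?_
        rw [norm_div, div_le_iff₀ (norm_pos_iff.2 hωz)]
        exact hschwarz _ hlt
      have h2 : (ω ((1 - ((0 : ℝ) : ℂ) * u) * z) / ω z).re = 1 := by simp [hωz]
      rw [h2, ← hsq]
      have h3 : ‖1 - ε * u‖ ≤ (1 + ‖1 - ε * u‖ ^ 2) / 2 := by
        nlinarith [sq_nonneg (‖1 - ε * u‖ - 1)]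
      norm_num
      linarith)
    linarith
  have him : M.im = 0 := by
    by_contra hne
    -- the direction `u = 1 + i y` with `y` large enough compared to `Re (M - 1)`
    have h1 := hdir (1 + ((((M - 1).re + 1) / M.im : ℝ) : ℂ) * Complex.I) (by simp)
    have h2 : (((M - 1).re + 1) / M.im) * M.im = (M - 1).re + 1 := div_mul_cancel₀ _ hne
    simp [Complex.add_re, Complex.mul_re] at h1 h2
    linarith
  have hre : 1 ≤ M.re := by simpa using hdir 1 (by simp)
  refine ⟨M.re, hre, ?_⟩
  have hMre : (M.re : ℂ) = M := Complex.ext (by simp) (by simp [him])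
  rw [hMre, hM, div_mul_cancel₀ _ hωz]

/-! ### Subordinants of `σ q + γ z q' ≺ σ g + γ z g'` -/

theorem ConvexFunction.univalent_superordinate {q : ℂ → ℂ} (hq : ConvexFunction q) {σ γ : ℂ}
    (hγ : γ ≠ 0) (hσγ : 0 < (σ / γ).re) :
    Univalent (fun z => σ * q z + γ * (z * deriv q z)) :=
  ((hq.univalent_mul_add hσγ).const_mul hγ).congr fun z _ => by
    simp only
    field_simp

theorem ConvexFunction.exists_superordinate_eq {q : ℂ → ℂ} (hq : ConvexFunction q) {σ γ : ℂ}
    (hγ : γ ≠ 0) (hσγ : 0 < (σ / γ).re) {z₀ : ℂ} (hz₀ : z₀ ∈ disc) {t : ℝ}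
    (ht : t ∈ Set.Icc (0 : ℝ) 1) :
    ∃ z ∈ disc, σ * q z + γ * (z * deriv q z) = σ * q z₀ + γ * (t * (z₀ * deriv q z₀)) := by
  obtain ⟨z, hz, h⟩ := hq.exists_mul_add_eq hσγ hz₀ ht
  refine ⟨z, hz, ?_⟩
  have h' := congrArg (γ * ·) h
  simp only [mul_add, ← mul_assoc, mul_div_cancel₀ _ hγ] at h' ⊢
  exact h'

/-- If `q(𝕌) ⊄ g(𝕌)`, let `z₁` be a point of least modulus with `q(z₁) ∉ g(𝕌)`, and
`ω = g⁻¹ ∘ q` on the disc of radius `‖z₁‖`. At a point `z` where `‖ω‖` is maximal on a smaller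
closed disc, Jack's lemma shows that `P = σ g + γ z g'` takes at `ω(z)` the value
`σ q(z) + γ t z q'(z)` with `t ∈ (0, 1]`. As the radius tends to `‖z₁‖`, these values accumulate at
a point of `h(𝕌) ⊆ P(𝕌)`, so the points `ω(z)` accumulate inside the disc. By maximality `ω` stays
in a compact subset of the disc along the radius to `z₁`, which forces `q(z₁) ∈ g(𝕌)`. -/
theorem ConvexFunction.subordinate_of_superordination {q g : ℂ → ℂ} {σ γ : ℂ}
    (hq : ConvexFunction q) (hγ : γ ≠ 0) (hσγ : 0 < (σ / γ).re) (hg : Univalent g)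
    (hP : Univalent (fun z => σ * g z + γ * (z * deriv g z)))
    (hsub : Subordinate (fun z => σ * q z + γ * (z * deriv q z))
      (fun z => σ * g z + γ * (z * deriv g z))) :
    Subordinate q g := by
  have hU := hq.1
  set P : ℂ → ℂ := fun z => σ * g z + γ * (z * deriv g z) with hPdef
  obtain ⟨v, -, hvm, hv0, hv⟩ := hsub
  have h00 : (0 : ℂ) ∈ disc := mem_ball_self one_pos
  have hσ : σ ≠ 0 := by rintro rfl; simp at hσγ
  have hqg : q 0 = g 0 := by
    have := hv 0 h00
    simp only [hv0, hPdef, zero_mul, mul_zero, add_zero] at this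
    exact mul_left_cancel₀ hσ this
  refine hg.subordinate_of_image_subset hU.1 hqg ?_
  by_contra hnot
  -- a point of least modulus among those which `q` maps outside `g(𝕌)`
  simp only [Set.MapsTo, not_forall] at hnot
  obtain ⟨ζ, hζ, hζg⟩ := hnot
  have hζ1 : ‖ζ‖ < 1 := by simpa using hζ
  have hζsub : closedBall (0 : ℂ) ‖ζ‖ ⊆ disc := closedBall_subset_ball hζ1
  have hKc : IsCompact (closedBall (0 : ℂ) ‖ζ‖ ∩ q ⁻¹' (g '' disc)ᶜ) :=
    (isCompact_closedBall _ _).of_isClosed_subset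
      ((hU.1.continuousOn.mono hζsub).preimage_isClosed_of_isClosed isClosed_closedBall
        hg.isOpen_image.isClosed_compl) Set.inter_subset_left
  obtain ⟨z₁, ⟨hz₁ζ, hz₁g⟩, hmin⟩ := hKc.exists_isMinOn ⟨ζ, by simp, hζg⟩
    continuous_norm.continuousOn
  have hz₁ : z₁ ∈ disc := hζsub hz₁ζ
  have hz₁1 : ‖z₁‖ < 1 := by simpa using hz₁
  have hz₁0 : z₁ ≠ 0 := by
    rintro rfl
    exact hz₁g ⟨0, h00, hqg.symm⟩
  have hz₁pos : 0 < ‖z₁‖ := norm_pos_iff.2 hz₁0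
  have hbsub : ball (0 : ℂ) ‖z₁‖ ⊆ disc := ball_subset_ball hz₁1.le
  have hball : ∀ x ∈ ball (0 : ℂ) ‖z₁‖, q x ∈ g '' disc := by
    intro x hx
    by_contra hxg
    have hx1 : ‖x‖ < ‖z₁‖ := by simpa using hx
    have hz₁ζ' : ‖z₁‖ ≤ ‖ζ‖ := by simpa using hz₁ζ
    exact absurd (hmin (show x ∈ closedBall (0 : ℂ) ‖ζ‖ ∩ q ⁻¹' (g '' disc)ᶜ from
      ⟨by simpa using hx1.le.trans hz₁ζ', hxg⟩)) (not_le.2 hx1)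
  set ω : ℂ → ℂ := discInv g ∘ q with hω
  have hωd : DifferentiableOn ℂ ω (ball 0 ‖z₁‖) := fun x hx =>
    ((hg.analyticAt_discInv (hball x hx)).differentiableAt.comp x
      (hU.analyticAt (hbsub hx)).differentiableAt).differentiableWithinAt
  have hωm : ∀ x ∈ ball (0 : ℂ) ‖z₁‖, ω x ∈ disc := fun x hx => discInv_mem (hball x hx)
  have hgω : ∀ x ∈ ball (0 : ℂ) ‖z₁‖, g (ω x) = q x := fun x hx => apply_discInv (hball x hx)
  have hω0 : ω 0 = 0 := by simp [hω, hqg, hg.discInv_apply h00]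
  -- Jack's lemma at a maximum point of `‖ω‖` on the closed disc of radius `s ‖z₁‖`
  have hkey : ∀ s ∈ Set.Ioo (0 : ℝ) 1, ∃ z τ,
      (z, τ) ∈ closedBall (0 : ℂ) ‖z₁‖ ×ˢ Set.Icc (0 : ℝ) 1 ∧ ω z ∈ disc ∧ ‖ω (s * z₁)‖ ≤ ‖ω z‖ ∧
      P (ω z) = σ * q z + γ * ((τ : ℂ) * (z * deriv q z)) := by
    intro s hs
    have hr : s * ‖z₁‖ < ‖z₁‖ := mul_lt_of_lt_one_left hz₁pos hs.2
    have hsubr : closedBall (0 : ℂ) (s * ‖z₁‖) ⊆ ball 0 ‖z₁‖ := closedBall_subset_ball hr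
    have hsz : (s : ℂ) * z₁ ∈ closedBall (0 : ℂ) (s * ‖z₁‖) := by
      simp [abs_of_pos hs.1]
    obtain ⟨z, hz, hzmax⟩ := (isCompact_closedBall (0 : ℂ) (s * ‖z₁‖)).exists_isMaxOn
      ⟨_, hsz⟩ (hωd.continuousOn.mono hsubr).norm
    have hzb := hsubr hz
    have hzd := hbsub hzb
    have hsz0 : ω (s * z₁) ≠ 0 := by
      intro h
      have h1 := hgω _ (hsubr hsz)
      rw [h, ← hqg] at h1
      have h2 := hU.2 h00 (hbsub (hsubr hsz)) h1
      exact mul_ne_zero (Complex.ofReal_ne_zero.2 hs.1.ne') hz₁0 h2.symm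
    have hωz : ω z ≠ 0 := norm_pos_iff.1 ((norm_pos_iff.2 hsz0).trans_le (hzmax hsz))
    obtain ⟨m, hm, hmz⟩ := exists_one_le_of_isMax_norm hωd hω0 hzb hωz (fun x hx =>
      hzmax (show x ∈ closedBall (0 : ℂ) (s * ‖z₁‖) by
        have : ‖z‖ ≤ s * ‖z₁‖ := by simpa using hz
        simpa using hx.trans this))
    have hm0 : 0 < m := zero_lt_one.trans_le hm
    have hchain : deriv q z = deriv g (ω z) * deriv ω z := by
      have h1 : HasDerivAt (g ∘ ω) (deriv g (ω z) * deriv ω z) z :=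
        (hg.analyticAt (hωm z hzb)).differentiableAt.hasDerivAt.comp z
          (hωd.differentiableAt (isOpen_ball.mem_nhds hzb)).hasDerivAt
      have h2 : q =ᶠ[𝓝 z] g ∘ ω := by
        filter_upwards [isOpen_ball.mem_nhds hzb] with x hx using (hgω x hx).symm
      rw [h2.deriv_eq, h1.deriv]
    refine ⟨z, m⁻¹, ⟨ball_subset_closedBall hzb, (inv_pos.2 hm0).le, inv_le_one_of_one_le₀ hm⟩,
      hωm z hzb, hzmax hsz, ?_⟩
    have hmC : (m : ℂ) ≠ 0 := Complex.ofReal_ne_zero.2 hm0.ne'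
    have h3 : z * deriv q z = m * (ω z * deriv g (ω z)) := by
      rw [hchain, mul_left_comm, hmz]; ring
    simp only [hPdef]
    rw [hgω z hzb, h3, Complex.ofReal_inv, inv_mul_cancel_left₀ hmC]
  -- let the radius tend to `‖z₁‖`
  set s : ℕ → ℝ := fun n => 1 - 1 / ((n : ℝ) + 2) with hs
  have hsI : ∀ n, s n ∈ Set.Ioo (0 : ℝ) 1 := by
    intro n
    have hn : (0 : ℝ) < (n : ℝ) + 2 := by positivity
    have h1 : 1 / ((n : ℝ) + 2) < 1 := by
      rw [div_lt_one hn]; linarith [(Nat.cast_nonneg n : (0 : ℝ) ≤ n)]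
    have h2 : 0 < 1 / ((n : ℝ) + 2) := by positivity
    exact ⟨by simp only [hs]; linarith, by simp only [hs]; linarith⟩
  have hslim : Tendsto s atTop (𝓝 1) := by
    have h1 : Tendsto (fun n : ℕ => 1 / ((n : ℝ) + 2)) atTop (𝓝 0) :=
      (tendsto_const_nhds (x := (1 : ℝ))).div_atTop
        (tendsto_atTop_add_const_right _ _ tendsto_natCast_atTop_atTop)
    rw [← sub_zero (1 : ℝ)]
    exact h1.const_sub 1
  choose z τ hmem hwd hle hrel using fun n => hkey (s n) (hsI n)
  obtain ⟨⟨z', τ'⟩, hlim, φ, hφ, hconv⟩ :=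
    ((isCompact_closedBall (0 : ℂ) ‖z₁‖).prod
      (isCompact_Icc (a := (0 : ℝ)) (b := 1))).tendsto_subseq hmem
  have hz' : z' ∈ disc := closedBall_subset_ball hz₁1 hlim.1
  have hzc : Tendsto (fun n => z (φ n)) atTop (𝓝 z') := hconv.fst_nhds
  have hτc : Tendsto (fun n => τ (φ n)) atTop (𝓝 τ') := hconv.snd_nhds
  obtain ⟨x, hx, hxeq⟩ := hq.exists_superordinate_eq hγ hσγ hz' hlim.2
  have hPlim : Tendsto (fun n => P (ω (z (φ n)))) atTop (𝓝 (P (v x))) := by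
    have h1 : P (v x) = σ * q z' + γ * ((τ' : ℂ) * (z' * deriv q z')) := by
      rw [← hxeq]; exact (hv x hx).symm
    rw [h1]
    simp only [hrel]
    have h2 := (hU.analyticAt hz').continuousAt.tendsto.comp hzc
    have h3 := (hU.analyticAt hz').deriv.continuousAt.tendsto.comp hzc
    have h4 := (Complex.continuous_ofReal.tendsto τ').comp hτc
    exact (h2.const_mul σ).add ((h4.mul (hzc.mul h3)).const_mul γ)
  have hwlim : Tendsto (fun n => ω (z (φ n))) atTop (𝓝 (v x)) := by
    have h1 := (hP.continuousAt_discInv ⟨v x, hvm hx, rfl⟩).tendsto.comp hPlim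
    rw [hP.discInv_apply (hvm hx)] at h1
    exact h1.congr fun n => hP.discInv_apply (hwd (φ n))
  -- the maximal values of `‖ω‖` tend to `‖v x‖ < 1`, and they bound `ω` on the segment `[0, z₁)`
  have hvx : ‖v x‖ < 1 := by simpa using hvm hx
  obtain ⟨ρ, hρ1, hρ2⟩ := exists_between hvx
  have hsz : Tendsto (fun n => (s (φ n) : ℂ) * z₁) atTop (𝓝 z₁) := by
    have h1 : Tendsto (fun n => s (φ n)) atTop (𝓝 1) := hslim.comp hφ.tendsto_atTop
    simpa using ((Complex.continuous_ofReal.tendsto 1).comp h1).mul_const z₁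
  have hqlim : Tendsto (fun n => q (s (φ n) * z₁)) atTop (𝓝 (q z₁)) :=
    (hU.analyticAt hz₁).continuousAt.tendsto.comp hsz
  have hρsub : closedBall (0 : ℂ) ρ ⊆ disc := closedBall_subset_ball hρ2
  have hclosed : IsClosed (g '' closedBall (0 : ℂ) ρ) :=
    ((isCompact_closedBall (0 : ℂ) ρ).image_of_continuousOn
      (hg.1.continuousOn.mono hρsub)).isClosed
  refine hz₁g (Set.image_mono hρsub (hclosed.mem_of_tendsto hqlim ?_))
  filter_upwards [hwlim.norm.eventually_lt_const hρ1] with n hn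
  have hin : (s (φ n) : ℂ) * z₁ ∈ ball (0 : ℂ) ‖z₁‖ := by
    have := hsI (φ n)
    simpa [abs_of_pos this.1] using mul_lt_of_lt_one_left hz₁pos this.2
  exact ⟨ω (s (φ n) * z₁), by simpa using (hle (φ n)).trans hn.le, hgω _ hin⟩

/-! ### The operator and the function `Ψ` -/

/-- The factor is `k(z) = 1 + z ∑ c_n z ^ n`, with `c` the coefficients of `f - z ^ p`. -/
theorem classA.exists_eventually_eq {p : ℕ} {f : ℂ → ℂ} (hf : f ∈ classA p) :
    ∃ k : ℂ → ℂ, AnalyticAt ℂ k 0 ∧ k 0 = 1 ∧ ∀ᶠ z in 𝓝 0, f z = z ^ p * k z := by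
  obtain ⟨-, c, hc⟩ := hf
  set u : ℂ → ℂ := fun z => ∑' n, c n * z ^ n with hu
  have hsum : ∀ z ∈ disc, HasSum (fun n => c n * z ^ n) (u z) := by
    intro z hz
    refine Summable.hasSum ?_
    rcases eq_or_ne z 0 with rfl | hz0
    · exact summable_of_ne_finset_zero (s := {0}) fun n hn => by
        simp [show n ≠ 0 by simpa using hn]
    · refine (((hc z hz).summable).mul_right (z ^ (p + 1))⁻¹).congr fun n => ?_
      rw [pow_add]
      field_simp
  have huan : AnalyticAt ℂ u 0 := by
    refine ⟨FormalMultilinearSeries.ofScalars ℂ c, hasFPowerSeriesAt_iff.2 ?_⟩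
    filter_upwards [ball_mem_nhds (0 : ℂ) one_pos] with z hz
    simpa [mul_comm] using hsum z hz
  refine ⟨fun z => 1 + z * u z, by fun_prop, by simp, ?_⟩
  filter_upwards [ball_mem_nhds (0 : ℂ) one_pos] with z hz
  have h1 := (hsum z hz).mul_left (z ^ (p + 1))
  have h2 := (hc z hz).unique (h1.congr_fun fun n => by rw [pow_add]; ring)
  rw [sub_eq_iff_eq_add] at h2
  rw [h2]
  ring

/-- The agreement near the origin holds in both branches of the definition of `continuation`. -/
theorem continuation_eventuallyEq {g : ℂ → ℂ} :
    continuation g =ᶠ[𝓝[≠] 0] g := by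
  by_cases h : ∃ G : ℂ → ℂ, DifferentiableOn ℂ G disc ∧ G =ᶠ[𝓝[≠] 0] g
  · simpa only [continuation, dif_pos h] using h.choose_spec.2
  · simp only [continuation, dif_neg h]
    rfl

/-- Near the origin `f = z ^ p k`, `f' = p z ^ (p - 1) α` with `k` and `α` close to `1`, and the
formula is the logarithmic derivative of `F = α ^ η k ^ (-μ)`. -/
theorem eventuallyEq_psiExpr {p : ℕ} (hp : 1 ≤ p) {η μ σ γ : ℂ} {f F : ℂ → ℂ}
    (hf : f ∈ classA p) (hF : F =ᶠ[𝓝[≠] 0] powerProduct p η μ f) :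
    (fun z => σ * F z + γ * (z * deriv F z)) =ᶠ[𝓝[≠] 0] psiExpr p η μ σ γ f := by
  obtain ⟨k, hk, hk0, hfk⟩ := classA.exists_eventually_eq hf
  have hpC : (p : ℂ) ≠ 0 := Nat.cast_ne_zero.2 (by omega)
  set α : ℂ → ℂ := fun z => k z + z * deriv k z / p with hα
  have hαan : AnalyticAt ℂ α 0 := by
    have := hk.deriv
    fun_prop
  have hα0 : α 0 = 1 := by simp [hα, hk0]
  have hkan := hk.eventually_analyticAt
  have hpow : ∀ z : ℂ, (p : ℂ) * z ^ (p - 1) * z = p * z ^ p := fun z => by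
    rw [mul_assoc, ← pow_succ, Nat.sub_add_cancel hp]
  have hf' : ∀ᶠ z in 𝓝 0, deriv f z = p * z ^ (p - 1) * α z := by
    filter_upwards [hfk.eventually_nhds, hkan] with z h1 h2
    rw [EventuallyEq.deriv_eq h1,
      ((hasDerivAt_pow p z).fun_mul h2.differentiableAt.hasDerivAt).deriv]
    have h3 : z ^ p * deriv k z = (p * z ^ (p - 1)) * (z * deriv k z / p) := by
      rw [← mul_div_assoc, ← mul_assoc, hpow]
      field_simp
    simp only [hα, mul_add, ← h3]
  have hslit : ∀ {φ : ℂ → ℂ}, AnalyticAt ℂ φ 0 → φ 0 = 1 →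
      ∀ᶠ z in 𝓝 0, φ z ∈ Complex.slitPlane := fun h1 h2 =>
    h1.continuousAt.eventually (Complex.isOpen_slitPlane.mem_nhds (by rw [h2]; simp))
  set β : ℂ → ℂ := fun z => (k z)⁻¹ with hβ
  have hk0' : k 0 ≠ 0 := by simp [hk0]
  have hβan : AnalyticAt ℂ β 0 := hk.inv hk0'
  have hprod : powerProduct p η μ f =ᶠ[𝓝[≠] 0] fun z => α z ^ η * β z ^ μ := by
    filter_upwards [hfk.filter_mono nhdsWithin_le_nhds, hf'.filter_mono nhdsWithin_le_nhds,
      self_mem_nhdsWithin] with z h1 h2 hz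
    have hz : z ≠ 0 := hz
    simp only [powerProduct]
    rw [h2, h1, mul_div_cancel_left₀ _ (mul_ne_zero hpC (pow_ne_zero _ hz)),
      div_mul_cancel_left₀ (pow_ne_zero _ hz)]
  have hFev : ∀ᶠ z in 𝓝[≠] 0, F =ᶠ[𝓝 z] fun z => α z ^ η * β z ^ μ := by
    filter_upwards [eventually_eventually_nhdsWithin.2 (hF.trans hprod), self_mem_nhdsWithin]
      with z h1 h2
    rwa [isOpen_compl_singleton.nhdsWithin_eq h2] at h1
  filter_upwards [hFev, hprod, self_mem_nhdsWithin, hfk.filter_mono nhdsWithin_le_nhds,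
    hf'.eventually_nhds.filter_mono nhdsWithin_le_nhds,
    (hslit hαan hα0).filter_mono nhdsWithin_le_nhds,
    (hslit hβan (by simp [hβ, hk0])).filter_mono nhdsWithin_le_nhds,
    hαan.eventually_analyticAt.filter_mono nhdsWithin_le_nhds,
    hkan.filter_mono nhdsWithin_le_nhds] with z hFz hpz hz hfz hfz' hαs hβs hαz hkz
  have hz : z ≠ 0 := hz
  have hαne : α z ≠ 0 := Complex.slitPlane_ne_zero hαs
  have hkne : k z ≠ 0 := fun h => Complex.slitPlane_ne_zero hβs (by simp [hβ, h])
  have hf1 : deriv f z = p * z ^ (p - 1) * α z := hfz'.self_of_nhds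
  have hzp : z ^ (p - 1) ≠ 0 := pow_ne_zero _ hz
  have hf2 : z * deriv (deriv f) z / deriv f z = (p - 1) + z * deriv α z / α z := by
    have h1 : z * ((p - 1 : ℕ) * z ^ (p - 1 - 1)) = ((p : ℂ) - 1) * z ^ (p - 1) := by
      rcases hp.eq_or_lt with rfl | hp2
      · simp
      · rw [mul_left_comm, ← pow_succ', Nat.sub_add_cancel (by omega), Nat.cast_sub hp,
          Nat.cast_one]
    rw [EventuallyEq.deriv_eq hfz', (((hasDerivAt_pow (p - 1) z).const_mul (p : ℂ)).fun_mul
      hαz.differentiableAt.hasDerivAt).deriv, hf1, mul_add]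
    rw [show z * ((p : ℂ) * ((p - 1 : ℕ) * z ^ (p - 1 - 1)) * α z)
      = p * (z * ((p - 1 : ℕ) * z ^ (p - 1 - 1))) * α z by ring, h1]
    field_simp
  have hf3 : (p : ℂ) - z * deriv f z / f z = - (z * deriv k z / k z) := by
    have h1 : z * deriv f z = z ^ p * (p * k z + z * deriv k z) := by
      rw [hf1, show z * ((p : ℂ) * z ^ (p - 1) * α z) = ((p : ℂ) * z ^ (p - 1) * z) * α z by ring,
        hpow]
      simp only [hα]
      field_simp
    rw [h1, hfz, mul_div_mul_left _ _ (pow_ne_zero _ hz)]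
    field_simp
    ring
  have hβd : HasDerivAt β (-deriv k z / k z ^ 2) z := hkz.differentiableAt.hasDerivAt.inv hkne
  have hFd : deriv F z = α z ^ η * β z ^ μ * (η * (deriv α z / α z) - μ * (deriv k z / k z)) := by
    rw [hFz.deriv_eq, ((hαz.differentiableAt.hasDerivAt.cpow_const hαs).fun_mul
      (hβd.cpow_const hβs)).deriv, Complex.cpow_sub _ _ hαne,
      Complex.cpow_sub _ _ (Complex.slitPlane_ne_zero hβs), Complex.cpow_one, Complex.cpow_one]
    simp only [hβ]
    field_simp
    ring
  have hpsi : psiExpr p η μ σ γ f z = powerProduct p η μ f z *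
      (σ + γ * (η * (1 - (p : ℂ) + z * deriv (deriv f) z / deriv f z) +
        μ * ((p : ℂ) - z * deriv f z / f z))) := rfl
  rw [hpsi, hpz, hFz.self_of_nhds, hFd, hf2, hf3]
  ring

theorem eqOn_Psi {p : ℕ} (hp : 1 ≤ p) {η μ σ γ : ℂ} {f : ℂ → ℂ} (hf : f ∈ classA p)
    (hF : DifferentiableOn ℂ (diffOp p η μ f) disc) :
    Set.EqOn (Psi p η μ σ γ f)
      (fun z => σ * diffOp p η μ f z + γ * (z * deriv (diffOp p η μ f) z)) disc :=
  continuation_eqOn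
    ((hF.const_mul σ).add ((differentiableOn_id.mul (hF.deriv isOpen_ball)).const_mul γ))
    (eventuallyEq_psiExpr hp hf continuation_eventuallyEq)

theorem injOn_of_mem_classQ {g : ℂ → ℂ} (hg : g ∈ classQ) : Set.InjOn g disc := by
  obtain ⟨G, hGg, -, hinj, -⟩ := hg
  have hsub : disc ⊆ closedBall (0 : ℂ) 1 \ excSet g := by
    refine fun z hz => ⟨ball_subset_closedBall hz, fun h => ?_⟩
    have h1 : ‖z‖ < 1 := by simpa using hz
    have h2 : ‖z‖ = 1 := by simpa using h.1
    exact h1.ne h2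
  exact hGg.injOn_iff.1 (hinj.mono hsub)

end PValent

theorem mainTheorem3 (p : ℕ) (hp : 1 ≤ p) (η μ σ γ : ℂ) (hγ : γ ≠ 0)
    (hσγ : 0 < (σ / γ).re)
    (q : ℂ → ℂ) (hq : PValent.ConvexFunction q) (hq0 : q 0 = 1)
    (f : ℂ → ℂ) (hf : f ∈ PValent.classA0 p η μ)
    (hF : PValent.diffOp p η μ f ∈ PValent.classH (q 0) 1 ∩ PValent.classQ)
    (hPsi : PValent.Univalent (PValent.Psi p η μ σ γ f))
    (hsub : PValent.Subordinate (fun z => σ * q z + γ * (z * deriv q z))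
      (PValent.Psi p η μ σ γ f)) :
    PValent.Subordinate q (PValent.diffOp p η μ f) ∧
      PValent.IsBestSubordinant (fun r s _ => σ * r + γ * s)
        (fun z => σ * q z + γ * (z * deriv q z)) q := by
  have hh := hq.univalent_superordinate hγ hσγ
  have hPsiEq := PValent.eqOn_Psi (η := η) (μ := μ) (σ := σ) (γ := γ) hp hf.1 hF.1.1
  refine ⟨hq.subordinate_of_superordination hγ hσγ
    ⟨hF.1.1, PValent.injOn_of_mem_classQ hF.2⟩ (hPsi.congr hPsiEq.symm)
    (hsub.congr_right hPsiEq), hh, hq.1, ⟨hq.1.1, ?_⟩, ?_⟩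
  · rintro g ⟨hg, hP, hgsub⟩
    exact hq.subordinate_of_superordination hγ hσγ hg hP hgsub
  · -- `q` itself satisfies the superordination
    intro r hr
    exact hr.2 q ⟨hq.1, hh, PValent.Subordinate.refl _⟩
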